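/- Let $S=K[x,y]$ be the polynomial ring in two variables over a field $K$ and let $\mathfrak m=(x,y)$. For an ideal $I$ of $S$ let $$\mathrm r(S/I)=\ell_S\bigl((I:_S\mathfrak m)/I\bigr)$$ denote the length of the socle of $S/I$ (the Cohen–Macaulay type of $S/I$ when $I$ is $\mathfrak m$-primary). A monomial ideal is an ideal generated by a set of monomials. Then the following hold. (a) Let $I$ be a monomial ideal of $S$. If $\mathrm r(S/I)\ge 5$, then $\mathrm r(S/I^2)\ge 8$. (b) For every positive integer $n$ there exists an $\mathfrak m$-primary monomial ideal $I$ of $S$ such that $$\mathrm r(S/I)>\mathrm r(S/I^2)>\cdots>\mathrm r(S/I^n)=(n+1)^2-1 .$$ -/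

import Mathlib

/-- The homogeneous maximal ideal `(x, y)` of `S = K[x, y]`, where `x = X 0` and `y = X 1`. -/
noncomputable def maxIdealXY (K : Type*) [Field K] : Ideal (MvPolynomial (Fin 2) K) :=
  Ideal.span {MvPolynomial.X 0, MvPolynomial.X 1}

/-- A monomial ideal of `K[x, y]`: an ideal generated by a set of monomials `x ^ (a 0) * y ^ (a 1)`. -/
def IsMonomialIdeal {K : Type*} [Field K] (I : Ideal (MvPolynomial (Fin 2) K)) : Prop :=
  ∃ A : Set (Fin 2 →₀ ℕ),
    I = Ideal.span ((fun a => MvPolynomial.monomial a (1 : K)) '' A)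

/-- `r(S/I) = ℓ_S((I :_S (x, y)) / I)`, the length of the socle of `S/I`. The quotient
`(I : (x, y)) / I` is realized as the image of `I : (x, y)` in `S/I`. -/
noncomputable def socleType {K : Type*} [Field K] (I : Ideal (MvPolynomial (Fin 2) K)) : ℕ∞ :=
  Module.length (MvPolynomial (Fin 2) K)
    (Submodule.map (Submodule.mkQ I)
      (Submodule.colon I (maxIdealXY K : Set (MvPolynomial (Fin 2) K))))

open scoped Pointwise

theorem Module.length_eq_length_of_smul_eq {R K M : Type*} [CommRing R] [Field K] [Algebra K R]
    [AddCommGroup M] [Module R M] [Module K M] [IsScalarTower K R M]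
    (h : ∀ r : R, ∃ c : K, ∀ x : M, r • x = c • x) :
    Module.length R M = Module.length K M := by
  let e : Submodule R M ≃o Submodule K M :=
    { toFun := Submodule.restrictScalars K
      invFun := fun p =>
        { p with
          smul_mem' := fun r x hx => by
            obtain ⟨c, hc⟩ := h r
            rw [hc x]
            exact p.smul_mem c hx }
      left_inv := fun p => by ext; rfl
      right_inv := fun p => by ext; rfl
      map_rel_iff' := Iff.rfl }
  apply WithBot.coe_injective
  rw [Module.coe_length, Module.coe_length, Order.krullDim_eq_of_orderIso e]

/-- The exponent vector of the monomial `x ^ p.1 * y ^ p.2`. -/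
noncomputable def expVec (p : ℕ × ℕ) : Fin 2 →₀ ℕ :=
  Finsupp.single 0 p.1 + Finsupp.single 1 p.2

@[simp] theorem expVec_zero (p : ℕ × ℕ) : expVec p 0 = p.1 := by simp [expVec]

@[simp] theorem expVec_one (p : ℕ × ℕ) : expVec p 1 = p.2 := by simp [expVec]

theorem expVec_apply (u : Fin 2 →₀ ℕ) : expVec (u 0, u 1) = u := by
  ext i; fin_cases i <;> simp

theorem expVec_injective : Function.Injective expVec := fun p q h => by
  ext
  · simpa using DFunLike.congr_fun h 0
  · simpa using DFunLike.congr_fun h 1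

theorem expVec_add (p q : ℕ × ℕ) : expVec (p + q) = expVec p + expVec q := by
  ext i; fin_cases i <;> simp

theorem expVec_le_iff {p : ℕ × ℕ} {u : Fin 2 →₀ ℕ} : expVec p ≤ u ↔ p ≤ (u 0, u 1) := by
  constructor
  · intro h
    exact ⟨by simpa using h 0, by simpa using h 1⟩
  · intro h i
    fin_cases i
    · simpa using h.1
    · simpa using h.2

/-- The ideal of `K[x, y]` generated by the monomials with exponents in `P`. -/
noncomputable def monomialIdeal (K : Type*) [Field K] (P : Set (ℕ × ℕ)) :
    Ideal (MvPolynomial (Fin 2) K) :=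
  Ideal.span ((fun p => MvPolynomial.monomial (expVec p) (1 : K)) '' P)

section

variable {K : Type*} [Field K]

theorem monomialIdeal_eq_span (P : Set (ℕ × ℕ)) :
    monomialIdeal K P =
      Ideal.span ((fun a => MvPolynomial.monomial a (1 : K)) '' (expVec '' P)) := by
  rw [monomialIdeal, Set.image_image]

theorem isMonomialIdeal_monomialIdeal (P : Set (ℕ × ℕ)) : IsMonomialIdeal (monomialIdeal K P) :=
  ⟨_, monomialIdeal_eq_span P⟩

theorem IsMonomialIdeal.exists_eq_monomialIdeal {I : Ideal (MvPolynomial (Fin 2) K)}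
    (hI : IsMonomialIdeal I) : ∃ P, I = monomialIdeal K P := by
  obtain ⟨A, rfl⟩ := hI
  refine ⟨(fun u : Fin 2 →₀ ℕ => (u 0, u 1)) '' A, ?_⟩
  have : expVec '' ((fun u : Fin 2 →₀ ℕ => (u 0, u 1)) '' A) = A := by
    rw [Set.image_image]
    simp [expVec_apply]
  rw [monomialIdeal_eq_span, this]

theorem mem_monomialIdeal {P : Set (ℕ × ℕ)} {f : MvPolynomial (Fin 2) K} :
    f ∈ monomialIdeal K P ↔ ∀ u ∈ f.support, (u 0, u 1) ∈ upperClosure P := by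
  rw [monomialIdeal_eq_span, MvPolynomial.mem_ideal_span_monomial_image]
  simp [expVec_le_iff, mem_upperClosure]

theorem monomialIdeal_congr {P Q : Set (ℕ × ℕ)} (h : upperClosure P = upperClosure Q) :
    monomialIdeal K P = monomialIdeal K Q := by
  ext f
  rw [mem_monomialIdeal, mem_monomialIdeal, h]

theorem monomialIdeal_mul (P Q : Set (ℕ × ℕ)) :
    monomialIdeal K P * monomialIdeal K Q = monomialIdeal K (P + Q) := by
  rw [monomialIdeal, monomialIdeal, monomialIdeal, Ideal.span_mul_span']
  congr 1
  ext f
  simp only [Set.mem_mul, Set.mem_image, Set.mem_add]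
  constructor
  · rintro ⟨_, ⟨p, hp, rfl⟩, _, ⟨q, hq, rfl⟩, rfl⟩
    exact ⟨p + q, ⟨p, hp, q, hq, rfl⟩, by simp [expVec_add]⟩
  · rintro ⟨_, ⟨p, hp, q, hq, rfl⟩, rfl⟩
    exact ⟨_, ⟨p, hp, rfl⟩, _, ⟨q, hq, rfl⟩, by simp [expVec_add]⟩

theorem monomialIdeal_pow (P : Set (ℕ × ℕ)) (n : ℕ) :
    monomialIdeal K P ^ n = monomialIdeal K (n • P) := by
  induction n with
  | zero =>
    rw [pow_zero, zero_nsmul, monomialIdeal, ← Set.singleton_zero, Set.image_singleton]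
    simp [expVec, ← Ideal.one_eq_top]
  | succ n ih => rw [pow_succ, ih, monomialIdeal_mul, succ_nsmul]

/-- The exponents of the monomials spanning the socle of `K[x, y]` modulo the monomial ideal with
exponent set `U`. -/
def socleSet (U : UpperSet (ℕ × ℕ)) : Set (ℕ × ℕ) :=
  {p | p ∉ U ∧ (p.1 + 1, p.2) ∈ U ∧ (p.1, p.2 + 1) ∈ U}

theorem mem_colon_maxIdealXY_iff {I : Ideal (MvPolynomial (Fin 2) K)}
    {f : MvPolynomial (Fin 2) K} :
    f ∈ Submodule.colon I (maxIdealXY K : Set (MvPolynomial (Fin 2) K)) ↔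
      f * MvPolynomial.X 0 ∈ I ∧ f * MvPolynomial.X 1 ∈ I := by
  rw [Submodule.mem_colon]
  constructor
  · intro h
    exact ⟨h _ (Ideal.subset_span (by simp)), h _ (Ideal.subset_span (by simp))⟩
  · rintro ⟨h0, h1⟩ g hg
    rw [SetLike.mem_coe, maxIdealXY, Ideal.mem_span_pair] at hg
    obtain ⟨a, b, rfl⟩ := hg
    have : f • (a * MvPolynomial.X 0 + b * MvPolynomial.X 1) =
        a * (f * MvPolynomial.X 0) + b * (f * MvPolynomial.X 1) := by
      rw [smul_eq_mul]; ring
    rw [this]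
    exact I.add_mem (I.mul_mem_left _ h0) (I.mul_mem_left _ h1)

theorem mem_colon_monomialIdeal {P : Set (ℕ × ℕ)} {f : MvPolynomial (Fin 2) K} :
    f ∈ Submodule.colon (monomialIdeal K P) (maxIdealXY K : Set (MvPolynomial (Fin 2) K)) ↔
      ∀ u ∈ f.support, (u 0 + 1, u 1) ∈ upperClosure P ∧ (u 0, u 1 + 1) ∈ upperClosure P := by
  rw [mem_colon_maxIdealXY_iff, mem_monomialIdeal, mem_monomialIdeal,
    MvPolynomial.support_mul_X, MvPolynomial.support_mul_X]
  simp only [Finset.mem_map, addRightEmbedding_apply, forall_exists_index, and_imp,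
    forall_apply_eq_imp_iff₂, Finsupp.add_apply]
  simp [forall_and]

theorem coeff_linearCombination_monomial {s : Set (ℕ × ℕ)} (l : s →₀ K) (p : s) :
    MvPolynomial.coeff (expVec p) (Finsupp.linearCombination K
      (fun q : s => MvPolynomial.monomial (expVec (q : ℕ × ℕ)) (1 : K)) l) = l p := by
  classical
  simp [Finsupp.linearCombination_apply, Finsupp.sum, MvPolynomial.coeff_sum,
    MvPolynomial.coeff_monomial, expVec_injective.eq_iff, Subtype.val_inj]
  tauto

theorem linearIndependent_socle (P : Set (ℕ × ℕ)) :
    LinearIndependent K (fun p : socleSet (upperClosure P) =>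
      Submodule.mkQ (monomialIdeal K P) (MvPolynomial.monomial (expVec (p : ℕ × ℕ)) (1 : K))) := by
  rw [linearIndependent_iff]
  intro l hl
  have h1 : Submodule.mkQ (monomialIdeal K P) (Finsupp.linearCombination K
      (fun q : socleSet (upperClosure P) =>
        MvPolynomial.monomial (expVec (q : ℕ × ℕ)) (1 : K)) l) = 0 := by
    rw [← hl]
    simp only [Finsupp.linearCombination_apply, Finsupp.sum, map_sum]
    rfl
  rw [Submodule.mkQ_apply, Submodule.Quotient.mk_eq_zero, mem_monomialIdeal] at h1
  ext p
  by_contra hp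
  refine p.2.1 ?_
  have := h1 (expVec p) (by
    rw [MvPolynomial.mem_support_iff, coeff_linearCombination_monomial]; exact hp)
  simpa using this

theorem restrictScalars_socle_eq_span (P : Set (ℕ × ℕ)) :
    (Submodule.map (Submodule.mkQ (monomialIdeal K P))
      (Submodule.colon (monomialIdeal K P)
        (maxIdealXY K : Set (MvPolynomial (Fin 2) K)))).restrictScalars K =
    Submodule.span K (Set.range (fun p : socleSet (upperClosure P) =>
      Submodule.mkQ (monomialIdeal K P)
        (MvPolynomial.monomial (expVec (p : ℕ × ℕ)) (1 : K)))) := by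
  apply le_antisymm
  · rintro _ ⟨f, hf, rfl⟩
    rw [SetLike.mem_coe, mem_colon_monomialIdeal] at hf
    rw [f.as_sum, map_sum]
    refine Submodule.sum_mem _ fun u hu => ?_
    by_cases hU : (u 0, u 1) ∈ upperClosure P
    · convert Submodule.zero_mem _
      rw [Submodule.mkQ_apply, Submodule.Quotient.mk_eq_zero, mem_monomialIdeal]
      intro v hv
      rw [Finset.mem_singleton.1 (MvPolynomial.support_monomial_subset hv)]
      exact hU
    · have : MvPolynomial.monomial u (f.coeff u) =
          f.coeff u • MvPolynomial.monomial (expVec (u 0, u 1)) (1 : K) := by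
        rw [expVec_apply, MvPolynomial.smul_monomial, smul_eq_mul, mul_one]
      rw [this]
      exact Submodule.smul_mem _ (f.coeff u) (Submodule.subset_span
        (Set.mem_range_self (⟨(u 0, u 1), hU, hf u hu⟩ : socleSet (upperClosure P))))
  · rw [Submodule.span_le]
    rintro _ ⟨p, rfl⟩
    refine ⟨_, ?_, rfl⟩
    rw [SetLike.mem_coe, mem_colon_monomialIdeal]
    intro u hu
    rw [Finset.mem_singleton.1 (MvPolynomial.support_monomial_subset hu)]
    simpa using p.2.2

theorem smul_socle_eq (P : Set (ℕ × ℕ)) (f : MvPolynomial (Fin 2) K)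
    (x : Submodule.map (Submodule.mkQ (monomialIdeal K P))
      (Submodule.colon (monomialIdeal K P) (maxIdealXY K : Set (MvPolynomial (Fin 2) K)))) :
    f • x = MvPolynomial.constantCoeff f • x := by
  obtain ⟨_, g, hg, rfl⟩ := x
  ext
  have hf : f - MvPolynomial.C (MvPolynomial.constantCoeff f) ∈ maxIdealXY K := by
    have : (maxIdealXY K) = Ideal.span (MvPolynomial.X '' (Set.univ : Set (Fin 2))) := by
      rw [maxIdealXY]; congr 1; ext; simp [eq_comm]
    rw [this, MvPolynomial.mem_ideal_span_X_image]
    intro u hu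
    by_contra! h
    have : u = 0 := by ext i; simpa using h i
    simp [this, MvPolynomial.mem_support_iff, MvPolynomial.constantCoeff_eq] at hu
  have key := Submodule.mem_colon.1 hg _ hf
  have : f • g - MvPolynomial.constantCoeff f • g ∈ monomialIdeal K P := by
    convert key using 1
    rw [smul_eq_mul, smul_eq_mul, MvPolynomial.smul_eq_C_mul]
    ring
  exact (Submodule.Quotient.eq (monomialIdeal K P)).2 this

theorem socleType_monomialIdeal (P : Set (ℕ × ℕ)) :
    socleType (monomialIdeal K P) = (socleSet (upperClosure P)).encard := by
  rw [socleType, Module.length_eq_length_of_smul_eq (K := K)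
    fun f => ⟨_, smul_socle_eq P f⟩]
  change Module.length K ((Submodule.map (Submodule.mkQ (monomialIdeal K P))
      (Submodule.colon (monomialIdeal K P)
        (maxIdealXY K : Set (MvPolynomial (Fin 2) K)))).restrictScalars K) = _
  rw [restrictScalars_socle_eq_span, Module.length_eq_rank,
    rank_span (linearIndependent_socle P)]
  change (Set.range _).encard = _
  rw [← Set.image_univ, (linearIndependent_socle (K := K) P).injective.encard_image,
    Set.encard_univ, Set.encard]

theorem radical_monomialIdeal {P : Set (ℕ × ℕ)} {a b : ℕ} (ha : (a, 0) ∈ P) (hb : (0, b) ∈ P)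
    (h0 : (0, 0) ∉ P) : (monomialIdeal K P).radical = maxIdealXY K := by
  have hX : (maxIdealXY K) = Ideal.span (MvPolynomial.X '' (Set.univ : Set (Fin 2))) := by
    rw [maxIdealXY]; congr 1; ext; simp [eq_comm]
  have hmem : ∀ f : MvPolynomial (Fin 2) K,
      f ∈ maxIdealXY K ↔ MvPolynomial.constantCoeff f = 0 := by
    intro f
    rw [hX, MvPolynomial.mem_ideal_span_X_image, MvPolynomial.constantCoeff_eq]
    constructor
    · intro h
      by_contra h1
      obtain ⟨i, -, hi⟩ := h 0 (MvPolynomial.mem_support_iff.2 h1)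
      exact hi rfl
    · intro h u hu
      by_contra! h1
      have : u = 0 := by ext i; simpa using h1 i
      exact MvPolynomial.mem_support_iff.1 hu (this ▸ h)
  have hprime : (maxIdealXY K).IsPrime := by
    have : maxIdealXY K = RingHom.ker (MvPolynomial.constantCoeff (σ := Fin 2) (R := K)) := by
      ext f; rw [hmem, RingHom.mem_ker]
    rw [this]
    exact RingHom.ker_isPrime _
  apply le_antisymm
  · rw [hprime.radical_le_iff]
    intro f hf
    rw [hmem, MvPolynomial.constantCoeff_eq]
    by_contra h1
    obtain ⟨q, hq, hq0⟩ := mem_upperClosure.1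
      (mem_monomialIdeal.1 hf 0 (MvPolynomial.mem_support_iff.2 h1))
    apply h0
    have : q = (0, 0) := by
      ext
      · simpa using hq0.1
      · simpa using hq0.2
    exact this ▸ hq
  · rw [maxIdealXY, Ideal.span_le]
    rintro _ (rfl | rfl)
    · refine ⟨a, Ideal.subset_span ⟨_, ha, ?_⟩⟩
      simp [expVec, MvPolynomial.X_pow_eq_monomial]
    · refine ⟨b, Ideal.subset_span ⟨_, hb, ?_⟩⟩
      simp [expVec, MvPolynomial.X_pow_eq_monomial]

end

theorem Nat.exists_not_and_succ {p : ℕ → Prop} {a b : ℕ} (hab : a ≤ b) (ha : ¬ p a) (hb : p b) :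
    ∃ c, a ≤ c ∧ c < b ∧ ¬ p c ∧ p (c + 1) := by
  induction b, hab using Nat.le_induction with
  | base => exact absurd hb ha
  | succ b hab ih =>
    by_cases h : p b
    · obtain ⟨c, h1, h2, h3⟩ := ih h
      exact ⟨c, h1, by omega, h3⟩
    · exact ⟨b, hab, by omega, h, hb⟩

theorem exists_mem_socleSet {U : UpperSet (ℕ × ℕ)} {v w : ℕ × ℕ} (hv : v ∈ U) (hw : w ∈ U)
    (h1 : v.1 ≤ w.1) (h2 : w.2 ≤ v.2) (h : (v.1, w.2) ∉ U) :
    ∃ s ∈ socleSet U, v.1 ≤ s.1 ∧ s.1 < w.1 := by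
  obtain ⟨x, hx1, hx2, hx3, hx4⟩ :=
    Nat.exists_not_and_succ (p := fun x => (x, w.2) ∈ U) h1 h hw
  obtain ⟨y, hy1, hy2, hy3, hy4⟩ :=
    Nat.exists_not_and_succ (p := fun y => (x, y) ∈ U) h2 hx3
      (U.upper (show v ≤ (x, v.2) from ⟨hx1, le_rfl⟩) hv)
  exact ⟨(x, y), ⟨hy3, U.upper (show (x + 1, w.2) ≤ (x + 1, y) from ⟨le_rfl, hy1⟩) hx4, hy4⟩,
    hx1, hx2⟩

/-- A descending staircase of points of `U` none of whose inner corners lies in `U` bounds the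
number of socle elements from below. -/
theorem le_encard_socleSet {U : UpperSet (ℕ × ℕ)} (w : ℕ → ℕ × ℕ) (r : ℕ)
    (hw : ∀ i ≤ r, w i ∈ U) (h1 : ∀ i < r, (w i).1 ≤ (w (i + 1)).1)
    (h2 : ∀ i < r, (w (i + 1)).2 ≤ (w i).2) (h : ∀ i < r, ((w i).1, (w (i + 1)).2) ∉ U) :
    (r : ℕ∞) ≤ (socleSet U).encard := by
  have key : ∀ i : Fin r, ∃ s ∈ socleSet U, (w i).1 ≤ s.1 ∧ s.1 < (w (i + 1)).1 := fun i =>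
    exists_mem_socleSet (hw i (by omega)) (hw (i + 1) (by omega)) (h1 i i.2) (h2 i i.2) (h i i.2)
  choose s hs hs1 hs2 using key
  have hmono : ∀ i j, i ≤ j → j ≤ r → (w i).1 ≤ (w j).1 := by
    intro i j hij hj
    induction j, hij using Nat.le_induction with
    | base => exact le_rfl
    | succ j hij ih => exact (ih (by omega)).trans (h1 j (by omega))
  have hlt : ∀ i j : Fin r, i < j → (s i).1 < (s j).1 := fun i j hij =>
    (hs2 i).trans_le ((hmono (i + 1) j (by omega) (by omega)).trans (hs1 j))
  have hinj : Function.Injective s := by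
    intro i j hij
    rcases lt_trichotomy i j with hlt' | heq | hlt'
    · exact absurd (hlt i j hlt') (by rw [hij]; exact lt_irrefl _)
    · exact heq
    · exact absurd (hlt j i hlt') (by rw [hij]; exact lt_irrefl _)
  calc (r : ℕ∞) = (Set.range s).encard := by
        rw [← Set.image_univ, hinj.encard_image, Set.encard_univ]; simp
    _ ≤ _ := Set.encard_le_encard (Set.range_subset_iff.2 hs)

theorem encard_socleSet_add_one_le (G : Finset (ℕ × ℕ)) (hG : G.Nonempty) :
    (socleSet (upperClosure (G : Set (ℕ × ℕ)))).encard + 1 ≤ G.card := by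
  obtain ⟨h, hh, hmin⟩ := G.exists_min_image Prod.fst hG
  have key : ∀ s ∈ socleSet (upperClosure (G : Set (ℕ × ℕ))),
      ∃ g ∈ G.erase h, g.1 = s.1 + 1 ∧ g.2 ≤ s.2 := by
    rintro ⟨x, y⟩ ⟨hs, hs1, hs2⟩
    rw [mem_upperClosure] at hs hs1 hs2
    obtain ⟨g, hg, hg1, hg2⟩ := hs1
    obtain ⟨g', hg', hg1', hg2'⟩ := hs2
    have hgx : g.1 = x + 1 := by
      by_contra hne
      exact hs ⟨g, hg, by simp only at hg1; change g.1 ≤ x; omega, hg2⟩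
    refine ⟨g, Finset.mem_erase.2 ⟨?_, hg⟩, hgx, hg2⟩
    rintro rfl
    have := hmin g' hg'
    simp only at hg1'
    omega
  choose! g hg hg1 hg2 using key
  have hinj : Set.InjOn g (socleSet (upperClosure (G : Set (ℕ × ℕ)))) := by
    have aux : ∀ s ∈ socleSet (upperClosure (G : Set (ℕ × ℕ))),
        ∀ t ∈ socleSet (upperClosure (G : Set (ℕ × ℕ))), s.1 = t.1 → t.2 ≤ s.2 := by
      intro s hs t ht hst
      by_contra hlt
      refine ht.1 ((upperClosure (G : Set (ℕ × ℕ))).upper ?_ hs.2.2)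
      exact ⟨hst.le, by change s.2 + 1 ≤ t.2; omega⟩
    intro s hs t ht hst
    have h1 : s.1 = t.1 := by
      have := hg1 s hs
      rw [hst, hg1 t ht] at this
      omega
    exact Prod.ext h1 (le_antisymm (aux t ht s hs h1.symm) (aux s hs t ht h1))
  have hle : (socleSet (upperClosure (G : Set (ℕ × ℕ)))).encard ≤
      ((G.erase h : Finset (ℕ × ℕ)) : Set (ℕ × ℕ)).encard :=
    Set.encard_le_encard_of_injOn (fun s hs => hg s hs) hinj
  calc _ ≤ ((G.erase h : Finset (ℕ × ℕ)) : Set (ℕ × ℕ)).encard + 1 := by gcongr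
    _ = G.card := by
      rw [Set.encard_coe_eq_coe_finsetCard, ← Finset.card_erase_add_one hh]
      norm_cast

theorem exists_finset_antichain_upperClosure_eq (P : Set (ℕ × ℕ)) :
    ∃ G : Finset (ℕ × ℕ), upperClosure (G : Set (ℕ × ℕ)) = upperClosure P ∧
      IsAntichain (· ≤ ·) (G : Set (ℕ × ℕ)) := by
  have hanti : IsAntichain (· ≤ ·) {p | Minimal (· ∈ P) p} := setOfPred_minimal_antichain _
  have hfin : {p | Minimal (· ∈ P) p}.Finite :=
    hanti.finite_of_partiallyWellOrderedOn (Set.isPWO_of_wellQuasiOrderedLE _)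
  refine ⟨hfin.toFinset, ?_, by simpa using hanti⟩
  ext p
  simp only [Set.Finite.coe_toFinset, SetLike.mem_coe, mem_upperClosure, Set.mem_ofPred_eq]
  constructor
  · rintro ⟨q, hq, hqp⟩
    exact ⟨q, hq.prop, hqp⟩
  · rintro ⟨q, hq, hqp⟩
    obtain ⟨q', hq', hmin⟩ := exists_minimal_le_of_wellFoundedLT (· ∈ P) q hq
    exact ⟨q', hmin, hq'.trans hqp⟩

theorem exists_staircase_upperClosure_eq (P : Set (ℕ × ℕ)) (k : ℕ)
    (hk : (k : ℕ∞) ≤ (socleSet (upperClosure P)).encard) (hk0 : k ≠ 0) :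
    ∃ (m : ℕ) (a b : ℕ → ℕ), k + 1 ≤ m ∧ (∀ i j, i < j → j < m → a i < a j ∧ b j < b i) ∧
      upperClosure P = upperClosure {p | ∃ i < m, p = (a i, b i)} := by
  obtain ⟨G, hG, hanti⟩ := exists_finset_antichain_upperClosure_eq P
  have hne : G.Nonempty := by
    rw [Finset.nonempty_iff_ne_empty]
    rintro rfl
    have : socleSet (upperClosure P) = ∅ := by
      rw [← hG]; ext; simp [socleSet]
    rw [this] at hk
    simp at hk
    exact hk0 hk
  have hcard : k + 1 ≤ G.card := by
    have h1 := encard_socleSet_add_one_le G hne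
    rw [hG] at h1
    have h2 : ((k + 1 : ℕ) : ℕ∞) ≤ (G.card : ℕ∞) := by
      push_cast
      exact (add_le_add_left hk 1).trans h1
    exact_mod_cast h2
  have hinj : Set.InjOn Prod.fst (G : Set (ℕ × ℕ)) := by
    intro p hp q hq hpq
    rcases le_total p.2 q.2 with h | h
    · exact hanti.eq hp hq ⟨hpq.le, h⟩
    · exact (hanti.eq hq hp ⟨hpq.ge, h⟩).symm
  have hX : (G.image Prod.fst).card = G.card := Finset.card_image_of_injOn hinj
  let e := (G.image Prod.fst).orderEmbOfFin hX
  have he : ∀ i : Fin G.card, ∃ y, (e i, y) ∈ G := by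
    intro i
    obtain ⟨p, hp, hpe⟩ := Finset.mem_image.1 (Finset.orderEmbOfFin_mem _ hX i)
    exact ⟨p.2, by convert hp; exact hpe.symm⟩
  choose f hf using he
  refine ⟨G.card, fun i => if h : i < G.card then e ⟨i, h⟩ else 0,
    fun i => if h : i < G.card then f ⟨i, h⟩ else 0, hcard, ?_, ?_⟩
  · intro i j hij hj
    have hi : i < G.card := hij.trans hj
    simp only [hi, hj, dif_pos]
    have h1 : e ⟨i, hi⟩ < e ⟨j, hj⟩ := e.strictMono hij
    refine ⟨h1, ?_⟩
    by_contra hle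
    have := hanti.eq (hf ⟨i, hi⟩) (hf ⟨j, hj⟩) ⟨h1.le, not_lt.1 hle⟩
    exact h1.ne (congrArg Prod.fst this)
  · rw [← hG]
    congr 1
    ext p
    constructor
    · intro hp
      obtain ⟨i, hi⟩ : ∃ i, e i = p.1 := by
        have : p.1 ∈ Set.range e := by
          rw [Finset.range_orderEmbOfFin]
          exact Finset.mem_image_of_mem _ hp
        exact this
      refine ⟨i, i.2, ?_⟩
      simp only [i.2, dif_pos]
      exact hinj hp (hf i) hi.symm
    · rintro ⟨i, hi, rfl⟩
      simpa only [hi, dif_pos, Finset.mem_coe] using hf ⟨i, hi⟩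

/-- Coordinates of the first three and the last three generators of a staircase, listed at the
indices `0, 1, 2, 4, 5, 6`, for an up-closed set `Q` of exponents of the square. At index `3` stands
the corner `(A 3, B 3)` below all other generators: `A 3` is the abscissa of the fourth generator
`(A 3, b')` and `B 3` is the ordinate of the fourth last generator `(a', B 3)`. -/
structure SquareFrame (Q : ℕ → ℕ → Prop) (A B : Fin 7 → ℕ) (a' b' : ℕ) : Prop where
  lt_A : A 0 < A 1 ∧ A 1 < A 2 ∧ A 2 < A 3 ∧ A 3 ≤ A 4 ∧ A 4 < A 5 ∧ A 5 < A 6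
  lt_B : B 1 < B 0 ∧ B 2 < B 1 ∧ B 3 ≤ B 2 ∧ B 4 < B 3 ∧ B 5 < B 4 ∧ B 6 < B 5
  lt_a' : A 2 ≤ a' ∧ a' < A 4
  lt_b' : B 4 ≤ b' ∧ b' < B 2
  mem : ∀ i j, i ≠ 3 → j ≠ 3 → Q (A i + A j) (B i + B j)
  mem_left : Q (A 0 + A 3) (B 0 + b')
  mem_right : Q (A 6 + a') (B 6 + B 3)
  exists_le : ∀ X Y, Q X Y → ∃ i j : Fin 7, i ≤ j ∧ A i + A j ≤ X ∧ B i + B j ≤ Y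

/-- The left end of a staircase in the square: two points after the second generator which are
separated from each other and from the sum of the second and the second last generator. -/
def LeftPair (Q : ℕ → ℕ → Prop) (A B : Fin 7 → ℕ) : Prop :=
  ∃ X₁ Y₁ X₂ Y₂, Q X₁ Y₁ ∧ Q X₂ Y₂ ∧ A 0 + A 1 ≤ X₁ ∧ X₁ ≤ X₂ ∧ X₂ ≤ A 1 + A 5 ∧
    Y₁ < B 0 + B 1 ∧ Y₂ ≤ Y₁ ∧ B 1 + B 5 ≤ Y₂ ∧ ¬ Q X₁ Y₂ ∧ ¬ Q X₂ (B 1 + B 5)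

/-- Five points strictly between the second and the second last generator of the square which are
pairwise separated. -/
def MiddleChain (Q : ℕ → ℕ → Prop) (A B : Fin 7 → ℕ) : Prop :=
  ∃ X₁ Y₁ X₂ Y₂ X₃ Y₃ X₄ Y₄ X₅ Y₅, Q X₁ Y₁ ∧ Q X₂ Y₂ ∧ Q X₃ Y₃ ∧ Q X₄ Y₄ ∧ Q X₅ Y₅ ∧
    (A 0 + A 1 ≤ X₁ ∧ X₁ ≤ X₂ ∧ X₂ ≤ X₃ ∧ X₃ ≤ X₄ ∧ X₄ ≤ X₅ ∧ X₅ < A 5 + A 6) ∧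
    (Y₁ < B 0 + B 1 ∧ Y₂ ≤ Y₁ ∧ Y₃ ≤ Y₂ ∧ Y₄ ≤ Y₃ ∧ Y₅ ≤ Y₄ ∧ B 5 + B 6 ≤ Y₅) ∧
    ¬ Q X₁ Y₂ ∧ ¬ Q X₂ Y₃ ∧ ¬ Q X₃ Y₄ ∧ ¬ Q X₄ Y₅

namespace SquareFrame

variable {Q : ℕ → ℕ → Prop} {A B : Fin 7 → ℕ} {a' b' : ℕ}

theorem swap (S : SquareFrame Q A B a' b') :
    SquareFrame (fun X Y => Q Y X) (fun i => B i.rev) (fun i => A i.rev) b' a' where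
  lt_A := by
    obtain ⟨h1, h2, h3, h4, h5, h6⟩ := S.lt_B
    exact ⟨h6, h5, h4, h3, h2, h1⟩
  lt_B := by
    obtain ⟨h1, h2, h3, h4, h5, h6⟩ := S.lt_A
    exact ⟨h6, h5, h4, h3, h2, h1⟩
  lt_a' := S.lt_b'
  lt_b' := S.lt_a'
  mem i j hi hj := S.mem i.rev j.rev (fun h => hi (Fin.rev_injective h))
    (fun h => hj (Fin.rev_injective h))
  mem_left := S.mem_right
  mem_right := S.mem_left
  exists_le X Y h := by
    obtain ⟨i, j, hij, h1, h2⟩ := S.exists_le Y X h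
    refine ⟨j.rev, i.rev, Fin.rev_le_rev.2 hij, ?_, ?_⟩
    · rw [Fin.rev_rev, Fin.rev_rev, add_comm]; exact h2
    · rw [Fin.rev_rev, Fin.rev_rev, add_comm]; exact h1

theorem cases_le (S : SquareFrame Q A B a' b') {X Y : ℕ} (h : Q X Y) :
    (A 0 + A 0 ≤ X ∧ B 0 + B 0 ≤ Y) ∨
    (A 0 + A 1 ≤ X ∧ B 0 + B 1 ≤ Y) ∨
    (A 0 + A 2 ≤ X ∧ B 0 + B 2 ≤ Y) ∨
    (A 0 + A 3 ≤ X ∧ B 0 + B 3 ≤ Y) ∨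
    (A 0 + A 4 ≤ X ∧ B 0 + B 4 ≤ Y) ∨
    (A 0 + A 5 ≤ X ∧ B 0 + B 5 ≤ Y) ∨
    (A 0 + A 6 ≤ X ∧ B 0 + B 6 ≤ Y) ∨
    (A 1 + A 1 ≤ X ∧ B 1 + B 1 ≤ Y) ∨
    (A 1 + A 2 ≤ X ∧ B 1 + B 2 ≤ Y) ∨
    (A 1 + A 3 ≤ X ∧ B 1 + B 3 ≤ Y) ∨
    (A 1 + A 4 ≤ X ∧ B 1 + B 4 ≤ Y) ∨
    (A 1 + A 5 ≤ X ∧ B 1 + B 5 ≤ Y) ∨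
    (A 1 + A 6 ≤ X ∧ B 1 + B 6 ≤ Y) ∨
    (A 2 + A 2 ≤ X ∧ B 2 + B 2 ≤ Y) ∨
    (A 2 + A 3 ≤ X ∧ B 2 + B 3 ≤ Y) ∨
    (A 2 + A 4 ≤ X ∧ B 2 + B 4 ≤ Y) ∨
    (A 2 + A 5 ≤ X ∧ B 2 + B 5 ≤ Y) ∨
    (A 2 + A 6 ≤ X ∧ B 2 + B 6 ≤ Y) ∨
    (A 3 + A 3 ≤ X ∧ B 3 + B 3 ≤ Y) ∨
    (A 3 + A 4 ≤ X ∧ B 3 + B 4 ≤ Y) ∨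
    (A 3 + A 5 ≤ X ∧ B 3 + B 5 ≤ Y) ∨
    (A 3 + A 6 ≤ X ∧ B 3 + B 6 ≤ Y) ∨
    (A 4 + A 4 ≤ X ∧ B 4 + B 4 ≤ Y) ∨
    (A 4 + A 5 ≤ X ∧ B 4 + B 5 ≤ Y) ∨
    (A 4 + A 6 ≤ X ∧ B 4 + B 6 ≤ Y) ∨
    (A 5 + A 5 ≤ X ∧ B 5 + B 5 ≤ Y) ∨
    (A 5 + A 6 ≤ X ∧ B 5 + B 6 ≤ Y) ∨
    (A 6 + A 6 ≤ X ∧ B 6 + B 6 ≤ Y) := by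
  obtain ⟨i, j, hij, h1, h2⟩ := S.exists_le X Y h
  fin_cases i <;> fin_cases j <;> first
    | exact absurd hij (by decide)
    | (simp only [Fin.zero_eta, Fin.mk_one, Fin.reduceFinMk] at h1 h2; simp [h1, h2])

theorem leftPair_of_incomparable (S : SquareFrame Q A B a' b')
    (h1 : ¬ (A 0 + A 2 ≤ 2 * A 1 ∧ B 0 + B 2 ≤ 2 * B 1))
    (h2 : ¬ (2 * A 1 ≤ A 0 + A 2 ∧ 2 * B 1 ≤ B 0 + B 2)) : LeftPair Q A B := by
  have hA := S.lt_A
  have hB := S.lt_B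
  have hb := S.lt_b'
  have m11 := S.mem 1 1 (by decide) (by decide)
  have m02 := S.mem 0 2 (by decide) (by decide)
  rcases Nat.lt_or_ge (2 * A 1) (A 0 + A 2) with h3 | h3
  · refine ⟨_, _, _, _, m11, m02, ?_, ?_, ?_, ?_, ?_, ?_, ?_, ?_⟩ <;> try omega
    all_goals intro h; have := S.cases_le h; omega
  · rcases Nat.lt_or_ge (2 * A 1) (A 0 + A 3) with h4 | h4
    · refine ⟨_, _, _, _, m02, m11, ?_, ?_, ?_, ?_, ?_, ?_, ?_, ?_⟩ <;> try omega
      all_goals intro h; have := S.cases_le h; omega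
    · refine ⟨_, _, _, _, m02, S.mem_left, ?_, ?_, ?_, ?_, ?_, ?_, ?_, ?_⟩ <;> try omega
      all_goals intro h; have := S.cases_le h; omega

theorem leftPair_of_comparable (S : SquareFrame Q A B a' b')
    (h1 : (A 0 + A 2 ≤ 2 * A 1 ∧ B 0 + B 2 ≤ 2 * B 1) ∨
      (2 * A 1 ≤ A 0 + A 2 ∧ 2 * B 1 ≤ B 0 + B 2))
    (h2 : ¬ (A 0 + A 6 ≤ A 1 + A 2 ∧ B 0 + B 6 ≤ B 1 + B 2)) : LeftPair Q A B := by
  have hA := S.lt_A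
  have hB := S.lt_B
  have m11 := S.mem 1 1 (by decide) (by decide)
  have m02 := S.mem 0 2 (by decide) (by decide)
  have m12 := S.mem 1 2 (by decide) (by decide)
  rcases h1 with h1 | h1
  · refine ⟨_, _, _, _, m02, m12, ?_, ?_, ?_, ?_, ?_, ?_, ?_, ?_⟩ <;> try omega
    all_goals intro h; have := S.cases_le h; omega
  · refine ⟨_, _, _, _, m11, m12, ?_, ?_, ?_, ?_, ?_, ?_, ?_, ?_⟩ <;> try omega
    all_goals intro h; have := S.cases_le h; omega

theorem middleChain_of_leftPair (S : SquareFrame Q A B a' b') (hl : LeftPair Q A B)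
    (hr : LeftPair (fun X Y => Q Y X) (fun i => B i.rev) (fun i => A i.rev)) :
    MiddleChain Q A B := by
  have m15 := S.mem 1 5 (by decide) (by decide)
  obtain ⟨X₁, Y₁, X₂, Y₂, q1, q2, l1, l2, l3, l4, l5, l6, n1, n2⟩ := hl
  obtain ⟨Y₅, X₅, Y₄, X₄, q5, q4, r1, r2, r3, r4, r5, r6, n4, n3⟩ := hr
  change B 6 + B 5 ≤ Y₅ at r1
  change Y₄ ≤ B 5 + B 1 at r3
  change X₅ < A 6 + A 5 at r4
  change A 5 + A 1 ≤ X₄ at r6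
  change ¬ Q (A 5 + A 1) Y₄ at n3
  rw [add_comm] at n3
  exact ⟨X₁, Y₁, X₂, Y₂, _, _, X₄, Y₄, X₅, Y₅, q1, q2, m15, q4, q5, by omega, by omega,
    n1, n2, n3, n4⟩

theorem middleChain_of_le (S : SquareFrame Q A B a' b')
    (h1 : (A 0 + A 2 ≤ 2 * A 1 ∧ B 0 + B 2 ≤ 2 * B 1) ∨
      (2 * A 1 ≤ A 0 + A 2 ∧ 2 * B 1 ≤ B 0 + B 2))
    (h2 : A 0 + A 6 ≤ A 1 + A 2 ∧ B 0 + B 6 ≤ B 1 + B 2) : MiddleChain Q A B := by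
  have hA := S.lt_A
  have hB := S.lt_B
  have m11 := S.mem 1 1 (by decide) (by decide)
  have m02 := S.mem 0 2 (by decide) (by decide)
  have m04 := S.mem 0 4 (by decide) (by decide)
  have m05 := S.mem 0 5 (by decide) (by decide)
  have m06 := S.mem 0 6 (by decide) (by decide)
  have m15 := S.mem 1 5 (by decide) (by decide)
  have m16 := S.mem 1 6 (by decide) (by decide)
  have m26 := S.mem 2 6 (by decide) (by decide)
  have m45 := S.mem 4 5 (by decide) (by decide)
  have m46 := S.mem 4 6 (by decide) (by decide)
  have m55 := S.mem 5 5 (by decide) (by decide)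
  by_cases h3 : 2 * A 5 ≤ A 4 + A 6 ∧ 2 * B 5 ≤ B 4 + B 6
  · rcases h1 with h1 | h1
    · refine ⟨_, _, _, _, _, _, _, _, _, _, m02, m04, m05, m06, m55, ?_, ?_, ?_, ?_, ?_, ?_⟩ <;>
        try omega
      all_goals intro h; have := S.cases_le h; omega
    · rcases Nat.lt_or_ge (B 0 + B 5) (2 * B 1) with h4 | h4
      · refine ⟨_, _, _, _, _, _, _, _, _, _, m11, m05, m06, m16, m55, ?_, ?_, ?_, ?_, ?_, ?_⟩ <;>
          try omega
        all_goals intro h; have := S.cases_le h; omega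
      · refine ⟨_, _, _, _, _, _, _, _, _, _, m11, m06, m15, m45, m55, ?_, ?_, ?_, ?_, ?_, ?_⟩ <;>
          try omega
        all_goals intro h; have := S.cases_le h; omega
  · rcases h1 with h1 | h1
    · refine ⟨_, _, _, _, _, _, _, _, _, _, m02, m04, m05, m06, m46, ?_, ?_, ?_, ?_, ?_, ?_⟩ <;>
        try omega
      all_goals intro h; have := S.cases_le h; omega
    · refine ⟨_, _, _, _, _, _, _, _, _, _, m11, m06, m16, m26, m46, ?_, ?_, ?_, ?_, ?_, ?_⟩ <;>
        try omega
      all_goals intro h; have := S.cases_le h; omega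

end SquareFrame

theorem MiddleChain.of_swap {Q : ℕ → ℕ → Prop} {A B : Fin 7 → ℕ}
    (h : MiddleChain (fun X Y => Q Y X) (fun i => B i.rev) (fun i => A i.rev)) :
    MiddleChain Q A B := by
  obtain ⟨Y₅, X₅, Y₄, X₄, Y₃, X₃, Y₂, X₂, Y₁, X₁, q5, q4, q3, q2, q1, ⟨r1, r2, r3, r4, r5, r6⟩,
    ⟨s1, s2, s3, s4, s5, s6⟩, n4, n3, n2, n1⟩ := h
  change B 6 + B 5 ≤ Y₅ at r1
  change Y₁ < B 1 + B 0 at r6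
  change X₅ < A 6 + A 5 at s1
  change A 1 + A 0 ≤ X₁ at s6
  exact ⟨X₁, Y₁, X₂, Y₂, X₃, Y₃, X₄, Y₄, X₅, Y₅, q1, q2, q3, q4, q5, by omega, by omega,
    n1, n2, n3, n4⟩

theorem SquareFrame.middleChain {Q : ℕ → ℕ → Prop} {A B : Fin 7 → ℕ} {a' b' : ℕ}
    (S : SquareFrame Q A B a' b') : MiddleChain Q A B := by
  have key : ∀ {Q : ℕ → ℕ → Prop} {A B : Fin 7 → ℕ} {a' b' : ℕ}, SquareFrame Q A B a' b' →
      LeftPair Q A B ∨ MiddleChain Q A B := by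
    intro Q A B a' b' S
    by_cases h1 : (A 0 + A 2 ≤ 2 * A 1 ∧ B 0 + B 2 ≤ 2 * B 1) ∨
        (2 * A 1 ≤ A 0 + A 2 ∧ 2 * B 1 ≤ B 0 + B 2)
    · by_cases h2 : A 0 + A 6 ≤ A 1 + A 2 ∧ B 0 + B 6 ≤ B 1 + B 2
      · exact Or.inr (S.middleChain_of_le h1 h2)
      · exact Or.inl (S.leftPair_of_comparable h1 h2)
    · rw [not_or] at h1
      exact Or.inl (S.leftPair_of_incomparable h1.1 h1.2)
  rcases key S with hl | h
  · rcases key S.swap with hr | h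
    · exact S.middleChain_of_leftPair hl hr
    · exact h.of_swap
  · exact h

theorem squareFrame_of_staircase {m : ℕ} {a b : ℕ → ℕ} (hm : 6 ≤ m)
    (hab : ∀ i j, i < j → j < m → a i < a j ∧ b j < b i) :
    SquareFrame (fun X Y => ∃ i j, i < m ∧ j < m ∧ a i + a j ≤ X ∧ b i + b j ≤ Y)
      ![a 0, a 1, a 2, a 3, a (m - 3), a (m - 2), a (m - 1)]
      ![b 0, b 1, b 2, b (m - 4), b (m - 3), b (m - 2), b (m - 1)] (a (m - 4)) (b 3) := by
  have hle : ∀ i j, i ≤ j → j < m → a i ≤ a j ∧ b j ≤ b i := by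
    intro i j hij hj
    rcases hij.eq_or_lt with rfl | h
    · exact ⟨le_rfl, le_rfl⟩
    · exact ⟨(hab i j h hj).1.le, (hab i j h hj).2.le⟩
  have hidx : ∀ i : Fin 7, i ≠ 3 → ∃ k < m,
      (![a 0, a 1, a 2, a 3, a (m - 3), a (m - 2), a (m - 1)] : Fin 7 → ℕ) i = a k ∧
      (![b 0, b 1, b 2, b (m - 4), b (m - 3), b (m - 2), b (m - 1)] : Fin 7 → ℕ) i = b k := by
    intro i hi
    fin_cases i
    · exact ⟨0, by omega, rfl, rfl⟩
    · exact ⟨1, by omega, rfl, rfl⟩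
    · exact ⟨2, by omega, rfl, rfl⟩
    · exact absurd rfl hi
    · exact ⟨m - 3, by omega, rfl, rfl⟩
    · exact ⟨m - 2, by omega, rfl, rfl⟩
    · exact ⟨m - 1, by omega, rfl, rfl⟩
  have hcov : ∀ k < m, ∃ i : Fin 7,
      (![a 0, a 1, a 2, a 3, a (m - 3), a (m - 2), a (m - 1)] : Fin 7 → ℕ) i ≤ a k ∧
      (![b 0, b 1, b 2, b (m - 4), b (m - 3), b (m - 2), b (m - 1)] : Fin 7 → ℕ) i ≤ b k := by
    intro k hk
    rcases (by omega : k = 0 ∨ k = 1 ∨ k = 2 ∨ (3 ≤ k ∧ k ≤ m - 4) ∨ k = m - 3 ∨ k = m - 2 ∨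
      k = m - 1) with rfl | rfl | rfl | h | rfl | rfl | rfl
    · exact ⟨0, le_rfl, le_rfl⟩
    · exact ⟨1, le_rfl, le_rfl⟩
    · exact ⟨2, le_rfl, le_rfl⟩
    · exact ⟨3, (hle 3 k h.1 hk).1, (hle k (m - 4) h.2 (by omega)).2⟩
    · exact ⟨4, le_rfl, le_rfl⟩
    · exact ⟨5, le_rfl, le_rfl⟩
    · exact ⟨6, le_rfl, le_rfl⟩
  refine ⟨⟨(hab 0 1 ?_ ?_).1, (hab 1 2 ?_ ?_).1, (hab 2 3 ?_ ?_).1, (hle 3 (m - 3) ?_ ?_).1,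
      (hab (m - 3) (m - 2) ?_ ?_).1, (hab (m - 2) (m - 1) ?_ ?_).1⟩,
    ⟨(hab 0 1 ?_ ?_).2, (hab 1 2 ?_ ?_).2, (hle 2 (m - 4) ?_ ?_).2, (hab (m - 4) (m - 3) ?_ ?_).2,
      (hab (m - 3) (m - 2) ?_ ?_).2, (hab (m - 2) (m - 1) ?_ ?_).2⟩,
    ⟨(hle 2 (m - 4) ?_ ?_).1, (hab (m - 4) (m - 3) ?_ ?_).1⟩,
    ⟨(hle 3 (m - 3) ?_ ?_).2, (hab 2 3 ?_ ?_).2⟩, ?_,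
    ⟨0, 3, by omega, by omega, le_rfl, le_rfl⟩,
    ⟨m - 1, m - 4, by omega, by omega, le_rfl, le_rfl⟩, ?_⟩ <;> try omega
  · intro i j hi hj
    obtain ⟨k, hk, h1, h2⟩ := hidx i hi
    obtain ⟨l, hl, h3, h4⟩ := hidx j hj
    exact ⟨k, l, hk, hl, by rw [h1, h3], by rw [h2, h4]⟩
  · rintro X Y ⟨k, l, hk, hl, h1, h2⟩
    obtain ⟨i, hi1, hi2⟩ := hcov k hk
    obtain ⟨j, hj1, hj2⟩ := hcov l hl
    rcases le_total i j with hij | hij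
    · exact ⟨i, j, hij, by omega, by omega⟩
    · exact ⟨j, i, hij, by omega, by omega⟩

theorem eight_le_encard_socleSet_square {m : ℕ} {a b : ℕ → ℕ} (hm : 6 ≤ m)
    (hab : ∀ i j, i < j → j < m → a i < a j ∧ b j < b i) {P : Set (ℕ × ℕ)}
    (hP : P = {p | ∃ i < m, p = (a i, b i)}) :
    8 ≤ (socleSet (upperClosure (P + P))).encard := by
  have hmem : ∀ X Y, (X, Y) ∈ upperClosure (P + P) ↔
      ∃ i j, i < m ∧ j < m ∧ a i + a j ≤ X ∧ b i + b j ≤ Y := by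
    intro X Y
    rw [mem_upperClosure]
    constructor
    · rintro ⟨_, ⟨p, hp, q, hq, rfl⟩, h⟩
      rw [hP] at hp hq
      obtain ⟨i, hi, rfl⟩ := hp
      obtain ⟨j, hj, rfl⟩ := hq
      exact ⟨i, j, hi, hj, h.1, h.2⟩
    · rintro ⟨i, j, hi, hj, h1, h2⟩
      refine ⟨_, Set.add_mem_add (a := (a i, b i)) (b := (a j, b j)) ?_ ?_, h1, h2⟩
      · rw [hP]; exact ⟨i, hi, rfl⟩
      · rw [hP]; exact ⟨j, hj, rfl⟩
  have S := squareFrame_of_staircase hm hab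
  obtain ⟨X₁, Y₁, X₂, Y₂, X₃, Y₃, X₄, Y₄, X₅, Y₅, q1, q2, q3, q4, q5, r, s, n1, n2, n3, n4⟩ :=
    S.middleChain
  have m00 := S.mem 0 0 (by decide) (by decide)
  have m01 := S.mem 0 1 (by decide) (by decide)
  have m56 := S.mem 5 6 (by decide) (by decide)
  have m66 := S.mem 6 6 (by decide) (by decide)
  have hA := S.lt_A
  have hB := S.lt_B
  have hc := fun X Y h => S.cases_le (X := X) (Y := Y) h
  generalize (![a 0, a 1, a 2, a 3, a (m - 3), a (m - 2), a (m - 1)] : Fin 7 → ℕ) = A at *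
  generalize (![b 0, b 1, b 2, b (m - 4), b (m - 3), b (m - 2), b (m - 1)] : Fin 7 → ℕ) = B at *
  refine le_encard_socleSet
    (![(A 0 + A 0, B 0 + B 0), (A 0 + A 1, B 0 + B 1), (X₁, Y₁), (X₂, Y₂), (X₃, Y₃), (X₄, Y₄),
      (X₅, Y₅), (A 5 + A 6, B 5 + B 6), (A 6 + A 6, B 6 + B 6)] ∘ Fin.ofNat 9) 8 ?_ ?_ ?_ ?_
  · intro i hi
    interval_cases i
    exacts [(hmem _ _).2 m00, (hmem _ _).2 m01, (hmem _ _).2 q1, (hmem _ _).2 q2,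
      (hmem _ _).2 q3, (hmem _ _).2 q4, (hmem _ _).2 q5, (hmem _ _).2 m56, (hmem _ _).2 m66]
  · intro i hi
    interval_cases i
    · change A 0 + A 0 ≤ A 0 + A 1; omega
    · change A 0 + A 1 ≤ X₁; omega
    · change X₁ ≤ X₂; omega
    · change X₂ ≤ X₃; omega
    · change X₃ ≤ X₄; omega
    · change X₄ ≤ X₅; omega
    · change X₅ ≤ A 5 + A 6; omega
    · change A 5 + A 6 ≤ A 6 + A 6; omega
  · intro i hi
    interval_cases i
    · change B 0 + B 1 ≤ B 0 + B 0; omega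
    · change Y₁ ≤ B 0 + B 1; omega
    · change Y₂ ≤ Y₁; omega
    · change Y₃ ≤ Y₂; omega
    · change Y₄ ≤ Y₃; omega
    · change Y₅ ≤ Y₄; omega
    · change B 5 + B 6 ≤ Y₅; omega
    · change B 6 + B 6 ≤ B 5 + B 6; omega
  · intro i hi
    interval_cases i
    · intro h; have := hc (A 0 + A 0) (B 0 + B 1) ((hmem _ _).1 h); omega
    · intro h; have := hc (A 0 + A 1) Y₁ ((hmem _ _).1 h); omega
    · exact fun h => n1 ((hmem _ _).1 h)
    · exact fun h => n2 ((hmem _ _).1 h)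
    · exact fun h => n3 ((hmem _ _).1 h)
    · exact fun h => n4 ((hmem _ _).1 h)
    · intro h; have := hc X₅ (B 5 + B 6) ((hmem _ _).1 h); omega
    · intro h; have := hc (A 5 + A 6) (B 6 + B 6) ((hmem _ _).1 h); omega

theorem eight_le_socleType_sq {K : Type*} [Field K] {I : Ideal (MvPolynomial (Fin 2) K)}
    (hI : IsMonomialIdeal I) (h : 5 ≤ socleType I) : 8 ≤ socleType (I ^ 2) := by
  obtain ⟨P, rfl⟩ := hI.exists_eq_monomialIdeal
  rw [socleType_monomialIdeal] at h
  obtain ⟨m, a, b, hm, hab, hP⟩ := exists_staircase_upperClosure_eq P 5 h (by norm_num)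
  rw [monomialIdeal_congr hP, monomialIdeal_pow, two_nsmul, socleType_monomialIdeal]
  exact eight_le_encard_socleSet_square hm hab rfl

/-- Rapidly growing sequence with `cornerScale n (j + 1) > cornerScale n j + cornerScale n j ^ n`. -/
def cornerScale (n : ℕ) : ℕ → ℕ
  | 0 => 4
  | j + 1 => cornerScale n j + (cornerScale n j ^ n + 1)

theorem cornerScale_succ (n j : ℕ) :
    cornerScale n (j + 1) = cornerScale n j + (cornerScale n j ^ n + 1) := rfl

theorem cornerScale_monotone (n : ℕ) : Monotone (cornerScale n) :=
  monotone_nat_of_le_succ fun j => by rw [cornerScale_succ]; omega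

theorem four_le_cornerScale (n j : ℕ) : 4 ≤ cornerScale n j :=
  cornerScale_monotone n (Nat.zero_le j)

/-- The side length of the cells in which the generators are placed. -/
def cellSize (n : ℕ) : ℕ := cornerScale n n

theorem cellSize_pos (n : ℕ) : 0 < cellSize n :=
  lt_of_lt_of_le (by norm_num) (four_le_cornerScale n n)

/-- The generators at the corners of the four outer cells. -/
def cornerGens (n : ℕ) : Finset (ℕ × ℕ) :=
  {(0, cellSize n * (n + 2)), (cellSize n, cellSize n * (n + 1)),
    (cellSize n * (n + 1), cellSize n), (cellSize n * (n + 2), 0)}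

/-- The `i`-th generator inside the inner cell with ordinate `j + 2`. -/
def innerGen (n j i : ℕ) : ℕ × ℕ :=
  (cellSize n * (n - j) + (cornerScale n j + i),
    cellSize n * (j + 2) + (cornerScale n j + (cornerScale n j ^ n - i)))

/-- Corner generators together with the generators inside the inner cells with abscissa greater
than `k`. -/
def cellGens (n k : ℕ) : Finset (ℕ × ℕ) :=
  cornerGens n ∪ (Finset.range (n - k)).biUnion fun j =>
    (Finset.range (cornerScale n j ^ n + 1)).image (innerGen n j)

theorem card_cellGens_le (n k : ℕ) : (cellGens n k).card ≤ cornerScale n (n - k) := by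
  have hsum : ∀ l, 4 + ∑ j ∈ Finset.range l, (cornerScale n j ^ n + 1) = cornerScale n l := by
    intro l
    induction l with
    | zero => rfl
    | succ l ih => rw [Finset.sum_range_succ, ← add_assoc, ih, cornerScale_succ]
  rw [← hsum]
  refine (Finset.card_union_le _ _).trans (add_le_add Finset.card_le_four
    (Finset.card_biUnion_le.trans (Finset.sum_le_sum fun j _ => ?_)))
  exact Finset.card_image_le.trans (Finset.card_range _).le

theorem mem_cellGens {n k : ℕ} {p : ℕ × ℕ} : p ∈ cellGens n k ↔
    p ∈ cornerGens n ∨ ∃ j i, j + k + 1 ≤ n ∧ i ≤ cornerScale n j ^ n ∧ p = innerGen n j i := by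
  simp only [cellGens, Finset.mem_union, Finset.mem_biUnion, Finset.mem_range, Finset.mem_image]
  refine or_congr_right ⟨?_, ?_⟩
  · rintro ⟨j, hj, i, hi, rfl⟩
    exact ⟨j, i, by omega, by omega, rfl⟩
  · rintro ⟨j, i, hj, hi, rfl⟩
    exact ⟨j, by omega, i, by omega, rfl⟩

theorem cellGens_subset {n k : ℕ} (hk : 1 ≤ k) : cellGens n k ⊆ cellGens n 1 := by
  intro p hp
  rw [mem_cellGens] at hp ⊢
  refine hp.imp_right ?_
  rintro ⟨j, i, hj, hi, rfl⟩
  exact ⟨j, i, by omega, hi, rfl⟩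

theorem exists_cell_of_mem_cornerGens {n : ℕ} {p : ℕ × ℕ} (hp : p ∈ cornerGens n) :
    ∃ c c', c + c' = n + 2 ∧ p = (cellSize n * c, cellSize n * c') ∧ (c ≤ 1 ∨ n + 1 ≤ c) := by
  simp only [cornerGens, Finset.mem_insert, Finset.mem_singleton] at hp
  rcases hp with rfl | rfl | rfl | rfl
  · exact ⟨0, n + 2, by omega, by simp, by omega⟩
  · exact ⟨1, n + 1, by omega, by simp, by omega⟩
  · exact ⟨n + 1, 1, by omega, by simp, by omega⟩
  · exact ⟨n + 2, 0, by omega, by simp, by omega⟩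

theorem exists_cell_of_mem_cellGens {n : ℕ} {p : ℕ × ℕ} (hp : p ∈ cellGens n 1) :
    ∃ c c' s t, c + c' = n + 2 ∧ p = (cellSize n * c + s, cellSize n * c' + t) ∧
      (c ≤ 1 ∨ n + 1 ≤ c ∨
        ∃ j, n ≤ c + j ∧ c ≤ n ∧ 2 * cornerScale n j + cornerScale n j ^ n ≤ s + t) := by
  rcases mem_cellGens.1 hp with h | ⟨j, i, hj, hi, rfl⟩
  · obtain ⟨c, c', h1, h2, h3⟩ := exists_cell_of_mem_cornerGens h
    exact ⟨c, c', 0, 0, h1, h2, by omega⟩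
  · exact ⟨n - j, j + 2, _, _, by omega, rfl, Or.inr (Or.inr ⟨j, by omega, by omega, by omega⟩)⟩

theorem exists_cell_of_mem_nsmul {n k : ℕ} {q : ℕ × ℕ}
    (hq : q ∈ k • (cellGens n 1 : Set (ℕ × ℕ))) :
    ∃ C C' s t, C + C' = k * (n + 2) ∧ q = (cellSize n * C + s, cellSize n * C' + t) ∧
      (C ≤ k ∨ n + 1 ≤ C ∨
        ∃ j, n ≤ C + j ∧ 2 * cornerScale n j + cornerScale n j ^ n ≤ s + t) := by
  induction k generalizing q with
  | zero =>
    rw [zero_nsmul, Set.mem_zero] at hq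
    exact ⟨0, 0, 0, 0, by simp, hq.trans (by ext <;> simp), by omega⟩
  | succ k ih =>
    rw [succ_nsmul] at hq
    obtain ⟨q, hq, p, hp, rfl⟩ := hq
    obtain ⟨C, C', s, t, h1, rfl, h2⟩ := ih hq
    obtain ⟨c, c', s', t', h3, rfl, h4⟩ := exists_cell_of_mem_cellGens hp
    refine ⟨C + c, C' + c', s + s', t + t', by rw [add_mul]; omega,
      by ext <;> simp <;> ring, ?_⟩
    rcases h2 with h2 | h2 | ⟨j, h2, h5⟩
    · rcases h4 with h4 | h4 | ⟨j, h4, -, h6⟩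
      · omega
      · omega
      · exact Or.inr (Or.inr ⟨j, by omega, by omega⟩)
    · omega
    · exact Or.inr (Or.inr ⟨j, by omega, by omega⟩)

theorem mem_nsmul_cellGens_or {n k K : ℕ} {q : ℕ × ℕ}
    (hq : q ∈ k • (cellGens n 1 : Set (ℕ × ℕ))) :
    q ∈ k • (cellGens n K : Set (ℕ × ℕ)) ∨
    ∃ C C', C + C' = k * (n + 2) ∧ (cellSize n * C + cornerScale n (n - K),
      cellSize n * C' + cornerScale n (n - K)) ≤ q := by
  induction k generalizing q with
  | zero =>
    rw [zero_nsmul] at hq ⊢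
    exact Or.inl hq
  | succ k ih =>
    rw [succ_nsmul] at hq ⊢
    obtain ⟨q, hq, p, hp, rfl⟩ := hq
    obtain ⟨c, c', s, t, h1, h2, -⟩ := exists_cell_of_mem_cellGens hp
    rcases ih hq with h | ⟨C, C', h3, h4⟩
    · by_cases hpK : p ∈ cellGens n K
      · exact Or.inl (Set.add_mem_add h hpK)
      · obtain ⟨C, C', s', t', h3, rfl, -⟩ := exists_cell_of_mem_nsmul hq
        rw [Finset.mem_coe, mem_cellGens] at hp
        rw [mem_cellGens] at hpK
        rcases hp with hp | ⟨j, i, hj, hi, rfl⟩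
        · exact absurd (Or.inl hp) hpK
        · have hjK : n - K ≤ j := by
            by_contra hlt
            exact hpK (Or.inr ⟨j, i, by omega, hi, rfl⟩)
          have := cornerScale_monotone n hjK
          refine Or.inr ⟨C + (n - j), C' + (j + 2), by rw [add_mul]; omega, ?_, ?_⟩
          · simp only [innerGen, mul_add, Prod.mk_add_mk]; omega
          · simp only [innerGen, mul_add, Prod.mk_add_mk]; omega
    · refine Or.inr ⟨C + c, C' + c', by rw [add_mul]; omega, ?_⟩
      obtain ⟨h5, h6⟩ := h4
      simp only at h5 h6
      subst h2
      constructor <;> simp only [mul_add, Prod.fst_add, Prod.snd_add] <;> omega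

theorem nsmul_add_nsmul_mem {P : Set (ℕ × ℕ)} {p q r : ℕ × ℕ} (hp : p ∈ P) (hq : q ∈ P)
    (hr : r ∈ P) (a b c : ℕ) : a • p + b • q + c • r ∈ (a + b + c) • P := by
  rw [add_nsmul, add_nsmul]
  exact Set.add_mem_add (Set.add_mem_add (Set.nsmul_mem_nsmul hp) (Set.nsmul_mem_nsmul hq))
    (Set.nsmul_mem_nsmul hr)

theorem cellSize_mul_mem_nsmul {n k K j r C' : ℕ} (hj : j ≤ k) (hr : r ≤ k)
    (h : j * (n + 1) + r + C' = k * (n + 2)) :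
    (cellSize n * (j * (n + 1) + r), cellSize n * C') ∈ k • (cellGens n K : Set (ℕ × ℕ)) := by
  have m0 : (0, cellSize n * (n + 2)) ∈ (cellGens n K : Set (ℕ × ℕ)) :=
    mem_cellGens.2 (Or.inl (by simp [cornerGens]))
  have m1 : (cellSize n, cellSize n * (n + 1)) ∈ (cellGens n K : Set (ℕ × ℕ)) :=
    mem_cellGens.2 (Or.inl (by simp [cornerGens]))
  have m2 : (cellSize n * (n + 1), cellSize n) ∈ (cellGens n K : Set (ℕ × ℕ)) :=
    mem_cellGens.2 (Or.inl (by simp [cornerGens]))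
  have m3 : (cellSize n * (n + 2), 0) ∈ (cellGens n K : Set (ℕ × ℕ)) :=
    mem_cellGens.2 (Or.inl (by simp [cornerGens]))
  rcases le_total r j with hrj | hrj
  · obtain ⟨u, rfl⟩ := Nat.exists_eq_add_of_le hrj
    obtain ⟨v, rfl⟩ := Nat.exists_eq_add_of_le hj
    have hC : C' = u + v * (n + 2) := by nlinarith
    convert nsmul_add_nsmul_mem m3 m2 m0 r u v using 1
    subst hC
    ext <;> simp <;> ring
  · obtain ⟨u, rfl⟩ := Nat.exists_eq_add_of_le hrj
    obtain ⟨v, rfl⟩ := Nat.exists_eq_add_of_le hr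
    have hC : C' = u * (n + 1) + v * (n + 2) := by nlinarith
    convert nsmul_add_nsmul_mem m3 m1 m0 j u v using 1
    subst hC
    ext <;> simp <;> ring

theorem exists_mem_nsmul_cellGens_le {n k C C' : ℕ} (hk : k ≤ n) (hC : C + C' = k * (n + 2)) :
    ∃ g ∈ k • (cellGens n k : Set (ℕ × ℕ)),
      g ≤ (cellSize n * C + cornerScale n (n - k), cellSize n * C' + cornerScale n (n - k)) := by
  obtain ⟨j, r, hj, hr, rfl⟩ : ∃ j r, j ≤ k ∧ (r ≤ k ∨ j < k ∧ r ≤ n) ∧ C = j * (n + 1) + r := by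
    rcases Nat.lt_or_ge C (k * (n + 1)) with h | h
    · have h1 : C / (n + 1) < k := Nat.div_lt_of_lt_mul (by rwa [mul_comm])
      exact ⟨C / (n + 1), C % (n + 1), h1.le,
        Or.inr ⟨h1, Nat.lt_succ_iff.1 (Nat.mod_lt _ (by omega))⟩, (Nat.div_add_mod' _ _).symm⟩
    · obtain ⟨r, rfl⟩ := Nat.exists_eq_add_of_le h
      exact ⟨k, r, le_rfl, Or.inl (by nlinarith), rfl⟩
  by_cases hrk : r ≤ k
  · exact ⟨_, cellSize_mul_mem_nsmul hj hrk hC, Nat.le_add_right _ _, Nat.le_add_right _ _⟩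
  · obtain ⟨hjk, hrn⟩ := hr.resolve_left hrk
    obtain ⟨k, rfl⟩ := Nat.exists_eq_succ_of_ne_zero (by omega : k ≠ 0)
    obtain ⟨l, rfl⟩ := Nat.exists_eq_add_of_le hrn
    have hle : j * (r + l + 1) ≤ k * (r + l + 1) := Nat.mul_le_mul_right _ (by omega)
    obtain ⟨D, hD⟩ : ∃ D, C' = D + (l + 2) := ⟨C' - (l + 2), by
      have : l + 2 ≤ C' := by
        rw [Nat.succ_mul] at hC
        nlinarith
      omega⟩
    subst hD
    have hmem : innerGen (r + l) l 0 ∈ (cellGens (r + l) (k + 1) : Set (ℕ × ℕ)) :=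
      mem_cellGens.2 (Or.inr ⟨l, 0, by omega, by omega, rfl⟩)
    have hmem' := cellSize_mul_mem_nsmul (n := r + l) (k := k) (K := k + 1) (j := j) (r := 0)
      (C' := D) (by omega) (by omega) (by rw [Nat.succ_mul] at hC; omega)
    refine ⟨_, by rw [Nat.succ_eq_add_one, succ_nsmul]; exact Set.add_mem_add hmem' hmem, ?_⟩
    have hS := cornerScale_monotone (r + l) (by omega : l + 1 ≤ r + l - (k + 1))
    rw [cornerScale_succ] at hS
    constructor
    · simp only [innerGen, Prod.fst_add, Nat.add_sub_cancel, mul_add, Nat.succ_eq_add_one]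
      omega
    · simp only [innerGen, Prod.snd_add, mul_add, Nat.succ_eq_add_one]
      omega

theorem upperClosure_nsmul_cellGens {n k : ℕ} (hk : 1 ≤ k) (hkn : k ≤ n) :
    upperClosure (k • (cellGens n 1 : Set (ℕ × ℕ))) =
      upperClosure ((k • cellGens n k : Finset (ℕ × ℕ)) : Set (ℕ × ℕ)) := by
  rw [Finset.coe_nsmul]
  ext p
  simp only [SetLike.mem_coe, mem_upperClosure]
  constructor
  · rintro ⟨q, hq, hqp⟩
    rcases mem_nsmul_cellGens_or (K := k) hq with h | ⟨C, C', h1, h2⟩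
    · exact ⟨q, h, hqp⟩
    · obtain ⟨g, hg, hle⟩ := exists_mem_nsmul_cellGens_le hkn h1
      exact ⟨g, hg, hle.trans (h2.trans hqp)⟩
  · rintro ⟨q, hq, hqp⟩
    exact ⟨q, Set.nsmul_subset_nsmul_left (Finset.coe_subset.2 (cellGens_subset hk)) hq, hqp⟩

theorem encard_socleSet_cellGens_add_one_le {n k : ℕ} (hk : 1 ≤ k) (hkn : k ≤ n) :
    (socleSet (upperClosure (k • (cellGens n 1 : Set (ℕ × ℕ))))).encard + 1 ≤
      (cornerScale n (n - k) ^ n : ℕ) := by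
  rw [upperClosure_nsmul_cellGens hk hkn]
  have hne : (cellGens n k).Nonempty := ⟨_, mem_cellGens.2 (Or.inl (Finset.mem_insert_self _ _))⟩
  refine (encard_socleSet_add_one_le _ hne.nsmul).trans ?_
  have h1 : (k • cellGens n k).card ≤ cornerScale n (n - k) ^ n :=
    Finset.card_nsmul_le.trans ((Nat.pow_le_pow_left (card_cellGens_le n k) k).trans
      (Nat.pow_le_pow_right (by have := four_le_cornerScale n (n - k); omega) hkn))
  exact_mod_cast h1

theorem le_of_cell_le {m C D s u : ℕ} (h : m * C + s ≤ m * D + u) (hu : u < m) : C ≤ D := by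
  by_contra hlt
  have : m * (D + 1) ≤ m * C := Nat.mul_le_mul_left _ (by omega)
  rw [mul_add] at this
  omega

theorem le_encard_socleSet_cellGens {n k : ℕ} (hk : 1 ≤ k) (hkn : k + 1 ≤ n) :
    ((cornerScale n (n - (k + 1)) ^ n : ℕ) : ℕ∞) ≤
      (socleSet (upperClosure (k • (cellGens n 1 : Set (ℕ × ℕ))))).encard := by
  obtain ⟨j, rfl⟩ := Nat.exists_eq_add_of_le hkn
  obtain ⟨k, rfl⟩ := Nat.exists_eq_add_of_le' hk
  have e1 : k + 1 + 1 + j - (k + 1 + 1) = j := by omega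
  rw [e1]
  set n := k + 1 + 1 + j with hn
  have hm : cornerScale n j + cornerScale n j ^ n < cellSize n := by
    have := cornerScale_monotone n (show j + 1 ≤ n by omega)
    rw [cornerScale_succ] at this
    rw [cellSize]
    omega
  refine le_encard_socleSet (fun i => (cellSize n * (k + 2) + (cornerScale n j + i),
    cellSize n * (j + 2 + k * (n + 2)) + (cornerScale n j + (cornerScale n j ^ n - i)))) _
    ?_ ?_ ?_ ?_
  · intro i hi
    rw [mem_upperClosure]
    have h0 : (0, cellSize n * (n + 2)) ∈ (cellGens n 1 : Set (ℕ × ℕ)) :=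
      mem_cellGens.2 (Or.inl (by simp [cornerGens]))
    have h1 : innerGen n j i ∈ (cellGens n 1 : Set (ℕ × ℕ)) :=
      mem_cellGens.2 (Or.inr ⟨j, i, by omega, hi, rfl⟩)
    refine ⟨_, by rw [succ_nsmul]; exact Set.add_mem_add (Set.nsmul_mem_nsmul h0) h1, le_of_eq ?_⟩
    have e2 : n - j = k + 2 := by omega
    rw [innerGen, e2]
    ext <;> simp
    ring
  · intro i hi
    simp only
    omega
  · intro i hi
    simp only
    omega
  · intro i hi h
    obtain ⟨q, hq, hle1, hle2⟩ := mem_upperClosure.1 h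
    obtain ⟨C, C', s, t, h1, rfl, h2⟩ := exists_cell_of_mem_nsmul hq
    simp only at hle1 hle2
    have hC := le_of_cell_le hle1 (by omega)
    have hC' := le_of_cell_le hle2 (by omega)
    have e3 : (k + 1) * (n + 2) = k * (n + 2) + (n + 2) := by ring
    obtain rfl : C = k + 2 := by omega
    obtain rfl : C' = j + 2 + k * (n + 2) := by omega
    rcases h2 with h2 | h2 | ⟨l, h2, h3⟩
    · omega
    · omega
    · have hS := cornerScale_monotone n (show j ≤ l by omega)
      have hS' := Nat.pow_le_pow_left hS n
      omega

theorem upperClosure_nsmul_cellGens_self (n : ℕ) :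
    upperClosure (n • (cellGens n 1 : Set (ℕ × ℕ))) =
      upperClosure (((Finset.range (n * (n + 2) + 1)).image fun C =>
        (cellSize n * C, cellSize n * (n * (n + 2) - C)) : Finset (ℕ × ℕ)) : Set (ℕ × ℕ)) := by
  ext p
  simp only [SetLike.mem_coe, mem_upperClosure, Finset.mem_image, Finset.mem_range]
  constructor
  · rintro ⟨q, hq, hqp⟩
    obtain ⟨C, C', s, t, h1, rfl, -⟩ := exists_cell_of_mem_nsmul hq
    obtain rfl : C' = n * (n + 2) - C := by omega
    exact ⟨_, ⟨C, by omega, rfl⟩,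
      le_trans ⟨Nat.le_add_right _ _, Nat.le_add_right _ _⟩ hqp⟩
  · rintro ⟨_, ⟨C, hC, rfl⟩, hqp⟩
    refine ⟨_, ?_, hqp⟩
    have h1 : C / (n + 1) < n + 1 := Nat.div_lt_of_lt_mul (by nlinarith)
    have h2 : C % (n + 1) < n + 1 := Nat.mod_lt _ (by omega)
    have := cellSize_mul_mem_nsmul (n := n) (k := n) (K := 1) (j := C / (n + 1))
      (r := C % (n + 1)) (C' := n * (n + 2) - C) (by omega) (by omega)
      (by rw [Nat.div_add_mod']; omega)
    rwa [Nat.div_add_mod'] at this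

theorem encard_socleSet_cellGens_self (n : ℕ) :
    (socleSet (upperClosure (n • (cellGens n 1 : Set (ℕ × ℕ))))).encard = (n * (n + 2) : ℕ) := by
  have hm := cellSize_pos n
  apply le_antisymm
  · rw [upperClosure_nsmul_cellGens_self]
    have h := (encard_socleSet_add_one_le _ ((Finset.nonempty_range_iff.2
      (Nat.succ_ne_zero (n * (n + 2)))).image fun C =>
        (cellSize n * C, cellSize n * (n * (n + 2) - C)))).trans
      (Nat.cast_le.2 (Finset.card_image_le.trans (Finset.card_range _).le))
    push_cast at h ⊢
    exact (ENat.add_le_add_iff_right ENat.one_ne_top).1 h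
  · refine le_encard_socleSet
      (fun C => (cellSize n * C, cellSize n * (n * (n + 2) - C))) _ ?_ ?_ ?_ ?_
    · intro C hC
      rw [upperClosure_nsmul_cellGens_self]
      exact subset_upperClosure (Finset.mem_coe.2
        (Finset.mem_image.2 ⟨C, Finset.mem_range.2 (by omega), rfl⟩))
    · intro C hC
      exact Nat.mul_le_mul_left _ (by omega)
    · intro C hC
      exact Nat.mul_le_mul_left _ (by omega)
    · intro C hC h
      obtain ⟨q, hq, hle1, hle2⟩ := mem_upperClosure.1 h
      obtain ⟨D, D', s, t, h1, rfl, -⟩ := exists_cell_of_mem_nsmul hq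
      simp only at hle1 hle2
      have hD := le_of_cell_le (u := 0) hle1 hm
      have hD' := le_of_cell_le (u := 0) hle2 hm
      omega

theorem radical_monomialIdeal_cellGens (K : Type*) [Field K] (n : ℕ) :
    (monomialIdeal K (cellGens n 1 : Set (ℕ × ℕ))).radical = maxIdealXY K := by
  refine radical_monomialIdeal (a := cellSize n * (n + 2)) (b := cellSize n * (n + 2))
    (mem_cellGens.2 (Or.inl (by simp [cornerGens])))
    (mem_cellGens.2 (Or.inl (by simp [cornerGens]))) fun h => ?_
  obtain ⟨c, c', s, t, h1, h2, -⟩ := exists_cell_of_mem_cellGens h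
  have hm := cellSize_pos n
  simp only [Prod.mk.injEq] at h2
  have h3 : cellSize n * c = 0 := by omega
  have h4 : cellSize n * c' = 0 := by omega
  have h5 := (Nat.mul_eq_zero.1 h3).resolve_left hm.ne'
  have h6 := (Nat.mul_eq_zero.1 h4).resolve_left hm.ne'
  omega

theorem exists_monomialIdeal_socleType_pow_descending (K : Type*) [Field K] (n : ℕ) :
    ∃ I : Ideal (MvPolynomial (Fin 2) K), IsMonomialIdeal I ∧ I.radical = maxIdealXY K ∧
      (∀ k : ℕ, 1 ≤ k → k < n → socleType (I ^ (k + 1)) < socleType (I ^ k)) ∧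
      socleType (I ^ n) = (((n + 1) ^ 2 - 1 : ℕ) : ℕ∞) := by
  refine ⟨monomialIdeal K (cellGens n 1 : Set (ℕ × ℕ)), isMonomialIdeal_monomialIdeal _,
    radical_monomialIdeal_cellGens K n, ?_, ?_⟩
  · intro k hk hkn
    rw [monomialIdeal_pow, monomialIdeal_pow, socleType_monomialIdeal, socleType_monomialIdeal]
    have h1 := encard_socleSet_cellGens_add_one_le (n := n) (k := k + 1) (by omega) hkn
    have h2 := h1.trans (le_encard_socleSet_cellGens hk hkn)
    refine lt_of_lt_of_le ?_ h2
    refine (ENat.lt_add_one_iff ?_).2 le_rfl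
    exact ne_top_of_le_ne_top (ENat.natCast_ne_top _) (le_self_add.trans h1)
  · rw [monomialIdeal_pow, socleType_monomialIdeal, encard_socleSet_cellGens_self]
    congr 1
    have : (n + 1) ^ 2 = n * (n + 2) + 1 := by ring
    omega

theorem corollary2p8 (K : Type*) [Field K] :
    (∀ I : Ideal (MvPolynomial (Fin 2) K), IsMonomialIdeal I →
      5 ≤ socleType I → 8 ≤ socleType (I ^ 2)) ∧
    (∀ n : ℕ, 1 ≤ n →
      ∃ I : Ideal (MvPolynomial (Fin 2) K), IsMonomialIdeal I ∧ I.radical = maxIdealXY K ∧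
        (∀ k : ℕ, 1 ≤ k → k < n → socleType (I ^ (k + 1)) < socleType (I ^ k)) ∧
        socleType (I ^ n) = (((n + 1) ^ 2 - 1 : ℕ) : ℕ∞)) :=
  ⟨fun _ hI h => eight_le_socleType_sq hI h,
    fun n _ => exists_monomialIdeal_socleType_pow_descending K n⟩
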